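/- Let $A$ be a C*-algebra, and let $I$ and $J$ be closed two-sided ideals of $A$, each of which is $\sigma$-unital (that is, has a countable approximate unit). Let $H$ be a countably generated right Hilbert C*-module over $A$. For a closed two-sided ideal $K$ of $A$ let $HK=\{h\cdot k : h\in H,\ k\in K\}$, which is a closed submodule of $H$ and is regarded as a Hilbert C*-module over $A$ with the $A$-valued inner product of $H$. Then there is an isomorphism of Hilbert C*-modules over $A$ (a bijective $A$-linear map preserving the $A$-valued inner products) \[HI\oplus HJ\;\cong\; H(I+J)\oplus H(I\cap J),\] where direct sums carry the inner product $\langle (x,y),(x',y')\rangle=\langle x,x'\rangle+\langle y,y'\rangle$. -/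

import Mathlib

open scoped InnerProductSpace RightActions WithCStarModule Topology
open Filter MulOpposite

/-!
Right Hilbert C⋆-modules over `A` are expressed through Mathlib's class `CStarModule`: its scalar
action satisfies `⟪x, c • y⟫ = c * ⟪x, y⟫`, so a *right* Hilbert `A`-module is a
`CStarModule Aᵐᵒᵖ H`, with `h <• a = op a • h` the right action of `a : A` on `h : H`, and
`⟪x, y <• a⟫ = op (unop ⟪x, y⟫ * a)`.
-/

namespace RightHilbert

section Basic

variable {B H : Type*} [NonUnitalCStarAlgebra B] [PartialOrder B]
  [NormedAddCommGroup H] [NormedSpace ℂ H] [SMul B H] [CStarModule B H]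

theorem ext_inner {x y : H} (h : ∀ z : H, ⟪z, x⟫_B = ⟪z, y⟫_B) : x = y := by
  have h0 : ⟪x - y, x - y⟫_B = 0 := by
    rw [CStarModule.inner_sub_right, h, sub_self]
  exact sub_eq_zero.mp (CStarModule.inner_self.mp h0)

theorem smul_add' (c : B) (x y : H) : c • (x + y) = c • x + c • y :=
  ext_inner (B := B) fun z => by simp [mul_add]

theorem smul_smul_comm' (c : B) (r : ℂ) (x : H) : c • (r • x) = r • (c • x) :=
  ext_inner (B := B) fun z => by simp [mul_smul_comm]

theorem mul_smul' (c d : B) (x : H) : (c * d) • x = c • (d • x) :=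
  ext_inner (B := B) fun z => by simp [mul_assoc]

theorem sub_smul' (c d : B) (x : H) : (c - d) • x = c • x - d • x :=
  ext_inner (B := B) fun z => by simp [sub_mul]

theorem norm_smul_sq (c : B) (x : H) : ‖c • x‖ ^ 2 = ‖c * ⟪x, x⟫_B * star c‖ := by
  rw [CStarModule.norm_sq_eq B]
  simp [mul_assoc]

theorem norm_smul_le' (c : B) (x : H) : ‖c • x‖ ≤ ‖c‖ * ‖x‖ := by
  refine (sq_le_sq₀ (norm_nonneg _) (by positivity)).mp ?_
  rw [norm_smul_sq]
  calc _ ≤ ‖c‖ * ‖⟪x, x⟫_B‖ * ‖star c‖ := (norm_mul_le _ _).trans (by gcongr; exact norm_mul_le _ _)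
    _ = _ := by rw [norm_star, ← CStarModule.norm_sq_eq B]; ring

/-- The action of a fixed element of the algebra, as a bounded operator. -/
noncomputable def smulL (c : B) : H →L[ℂ] H :=
  LinearMap.mkContinuous
    { toFun := fun x => c • x
      map_add' := smul_add' c
      map_smul' := smul_smul_comm' c } ‖c‖ (norm_smul_le' c)

@[simp] theorem smulL_apply (c : B) (x : H) : smulL c x = c • x := rfl

variable [StarOrderedRing B]

theorem norm_cfc_smul_le {b : B} (hb : 0 ≤ b) {x : H} (hx : ⟪x, x⟫_B = cfcₙ (fun s : ℝ => s ^ 4) b)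
    {f : ℝ → ℝ} (hf : Continuous f) (hf0 : f 0 = 0) {C : ℝ} (hC : 0 ≤ C)
    (hfC : ∀ s, 0 ≤ s → s ^ 2 * |f s| ≤ C) : ‖cfcₙ f b • x‖ ≤ C := by
  refine (sq_le_sq₀ (norm_nonneg _) hC).mp ?_
  rw [norm_smul_sq, hx, ← cfcₙ_star,
    ← cfcₙ_mul f _ b hf.continuousOn hf0 (by fun_prop) (by simp),
    ← cfcₙ_mul _ _ b (by fun_prop) (by simp [hf0]) (by fun_prop) (by simp [hf0])]
  refine norm_cfcₙ_le fun s hs => ?_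
  have h0 : 0 ≤ s := quasispectrum_nonneg_of_nonneg b hb s hs
  have h1 := hfC s h0
  have h2 : ‖f s * s ^ 4 * star (f s)‖ = (s ^ 2 * |f s|) ^ 2 := by
    simp only [star_trivial, norm_mul, norm_pow, Real.norm_eq_abs, abs_of_nonneg h0]
    ring
  rw [h2]
  gcongr

/-- Every element `x` of a Hilbert C⋆-module is a product `b • y` where `b` belongs to the closed
one-sided ideal generated by `⟪x, x⟫`. -/
theorem exists_factor [CompleteSpace H] (x : H) : ∃ (b : B) (y : H),
    b ∈ closure (Set.range fun c : B => ⟪x, x⟫_B * c) ∧ b • y = x := by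
  set a : B := ⟪x, x⟫_B with ha
  have ha0 : 0 ≤ a := CStarModule.inner_self_nonneg
  set b : B := CFC.sqrt (CFC.sqrt a) with hbdef
  have hb : 0 ≤ b := CFC.sqrt_nonneg _
  have hbs : IsSelfAdjoint b := hb.isSelfAdjoint
  have hab : a = cfcₙ (fun s : ℝ => s ^ 4) b := by
    have h1 : a = (b * b) * (b * b) := by
      rw [hbdef, CFC.sqrt_mul_sqrt_self _ (CFC.sqrt_nonneg _), CFC.sqrt_mul_sqrt_self _ ha0]
    have h2 : b * b = cfcₙ (fun s : ℝ => s * s) b := by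
      rw [cfcₙ_mul (fun s : ℝ => s) (fun s : ℝ => s) b, cfcₙ_id' ℝ b]
    rw [h1, h2, ← cfcₙ_mul _ _ b (by fun_prop) (by simp) (by fun_prop) (by simp)]
    congr 1
    ext s
    ring
  let d : ℕ → ℝ := fun n => 1 / ((n : ℝ) + 1)
  have hd : ∀ n, 0 < d n := fun n => Nat.one_div_pos_of_nat
  have hdlim : Tendsto d atTop (𝓝 0) := tendsto_one_div_add_atTop_nhds_zero_nat
  have hden : ∀ n (s : ℝ), 0 < s ^ 4 + d n ^ 4 := fun n s => by
    have := hd n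
    positivity
  have hq : ∀ k n, Continuous fun s : ℝ => s ^ k / (s ^ 4 + d n ^ 4) := fun k n =>
    (by fun_prop : Continuous fun s : ℝ => s ^ k).div (by fun_prop) fun s => (hden n s).ne'
  have key : ∀ n (s : ℝ), 0 ≤ s → |s - s ^ 5 / (s ^ 4 + d n ^ 4)| ≤ d n := by
    intro n s hs
    have hdn := hd n
    have h1 : s - s ^ 5 / (s ^ 4 + d n ^ 4) = s * d n ^ 4 / (s ^ 4 + d n ^ 4) := by
      field_simp [(hden n s).ne']
      ring
    rw [h1, abs_of_nonneg (by have := hden n s; positivity), div_le_iff₀ (hden n s)]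
    rcases le_total s (d n) with h | h
    · have : s * d n ^ 4 ≤ d n * d n ^ 4 := by gcongr
      have : 0 ≤ d n * s ^ 4 := by positivity
      nlinarith
    · have : s * d n ^ 3 ≤ s * s ^ 3 := by gcongr
      nlinarith [pow_pos hdn 5]
  -- the approximations of the second factor
  let f : ℕ → ℝ → ℝ := fun n s => s ^ 3 / (s ^ 4 + d n ^ 4)
  have hf : ∀ n, Continuous (f n) := fun n => hq 3 n
  have hf0 : ∀ n, f n 0 = 0 := fun n => by simp [f]
  let y : ℕ → H := fun n => cfcₙ (f n) b • x
  have hy : ∀ n m, ‖y n - y m‖ ≤ d n + d m := by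
    intro n m
    have h1 : y n - y m = cfcₙ (fun s => f n s - f m s) b • x := by
      rw [cfcₙ_sub (f n) (f m) b (hf n).continuousOn (hf0 n) (hf m).continuousOn (hf0 m), sub_smul']
    rw [h1]
    refine norm_cfc_smul_le hb hab ((hf n).sub (hf m)) (by simp [hf0])
      (add_nonneg (hd n).le (hd m).le) fun s hs => ?_
    have h2 : s ^ 2 * |f n s - f m s| =
        |(s - s ^ 5 / (s ^ 4 + d m ^ 4)) - (s - s ^ 5 / (s ^ 4 + d n ^ 4))| := by
      rw [← abs_of_nonneg (sq_nonneg s), ← abs_mul]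
      congr 1
      simp only [f]
      ring
    change s ^ 2 * |f n s - f m s| ≤ d n + d m
    rw [h2, add_comm (d n)]
    exact (abs_sub _ _).trans (add_le_add (key m s hs) (key n s hs))
  have hcau : CauchySeq y := by
    rw [Metric.cauchySeq_iff']
    intro e he
    obtain ⟨N, hN⟩ := (hdlim.eventually (gt_mem_nhds (half_pos he))).exists_forall_of_atTop
    refine ⟨N, fun n hn => ?_⟩
    rw [dist_eq_norm]
    linarith [hy n N, hN n hn, hN N le_rfl]
  obtain ⟨z, hz⟩ := cauchySeq_tendsto_of_complete hcau
  refine ⟨b, z, ?_, ?_⟩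
  · refine mem_closure_of_tendsto (f := fun n => a * cfcₙ (fun s : ℝ => s ^ 1 / (s ^ 4 + d n ^ 4)) b)
      (b := atTop) ?_ (Eventually.of_forall fun n => ⟨_, rfl⟩)
    rw [tendsto_iff_norm_sub_tendsto_zero]
    refine squeeze_zero (fun _ => norm_nonneg _) (fun n => ?_) hdlim
    have h1 : a * cfcₙ (fun s : ℝ => s ^ 1 / (s ^ 4 + d n ^ 4)) b - b =
        cfcₙ (fun s : ℝ => s ^ 4 * (s ^ 1 / (s ^ 4 + d n ^ 4)) - s) b := by
      rw [cfcₙ_sub (fun s : ℝ => s ^ 4 * (s ^ 1 / (s ^ 4 + d n ^ 4))) (fun s => s) b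
        ((by fun_prop : Continuous fun s : ℝ => s ^ 4).mul (hq 1 n)).continuousOn
        (by simp) (by fun_prop) rfl,
        cfcₙ_mul _ _ b (by fun_prop) (by simp) (hq 1 n).continuousOn (by simp), ← hab,
        cfcₙ_id' ℝ b]
    rw [h1]
    refine norm_cfcₙ_le fun s hs => ?_
    have h2 := key n s (quasispectrum_nonneg_of_nonneg b hb s hs)
    rw [abs_sub_comm] at h2
    have h3 : s ^ 4 * (s ^ 1 / (s ^ 4 + d n ^ 4)) - s = s ^ 5 / (s ^ 4 + d n ^ 4) - s := by ring
    rw [h3, Real.norm_eq_abs]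
    exact h2
  · have hlim : Tendsto (fun n => b • y n) atTop (𝓝 (b • z)) :=
      ((smulL b : H →L[ℂ] H).continuous.tendsto z).comp hz
    refine tendsto_nhds_unique hlim ?_
    rw [tendsto_iff_norm_sub_tendsto_zero]
    refine squeeze_zero (fun _ => norm_nonneg _) (fun n => ?_)
      (by simpa using hdlim.pow 2 : Tendsto (fun n => d n ^ 2) atTop (𝓝 0))
    let g : ℝ → ℝ := fun s => s ^ 4 / (s ^ 4 + d n ^ 4)
    have hg : Continuous g := hq 4 n
    have hg0 : g 0 = 0 := by simp [g]
    have hbf : b * cfcₙ (f n) b = cfcₙ g b := by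
      have h1 : cfcₙ (fun s : ℝ => s * f n s) b = b * cfcₙ (f n) b := by
        rw [cfcₙ_mul (fun s : ℝ => s) (f n) b (by fun_prop) rfl (hf n).continuousOn (hf0 n),
          cfcₙ_id' ℝ b]
      rw [← h1]
      congr 1
      ext s
      simp only [f, g]
      ring
    have hgs : star (cfcₙ g b) = cfcₙ g b := by simp [← cfcₙ_star]
    have h1 : b • y n = cfcₙ g b • x := by
      rw [← hbf, mul_smul']
    refine (sq_le_sq₀ (norm_nonneg _) (by positivity)).mp ?_
    rw [h1, CStarModule.norm_sq_eq B]
    have hga : cfcₙ g b * a = cfcₙ (fun s => g s * s ^ 4) b := by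
      rw [cfcₙ_mul g _ b hg.continuousOn hg0 (by fun_prop) (by simp), ← hab]
    have hag : a * cfcₙ g b = cfcₙ (fun s => s ^ 4 * g s) b := by
      rw [cfcₙ_mul _ g b (by fun_prop) (by simp) hg.continuousOn hg0, ← hab]
    have hgag : cfcₙ g b * a * cfcₙ g b = cfcₙ (fun s => g s * s ^ 4 * g s) b := by
      rw [hga, ← cfcₙ_mul _ g b (by fun_prop) (by simp [hg0]) hg.continuousOn hg0]
    have h2 : ⟪cfcₙ g b • x - x, cfcₙ g b • x - x⟫_B =
        cfcₙ (fun s => (g s * s ^ 4 * g s - s ^ 4 * g s) - (g s * s ^ 4 - s ^ 4)) b := by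
      rw [cfcₙ_sub (fun s => g s * s ^ 4 * g s - s ^ 4 * g s) (fun s => g s * s ^ 4 - s ^ 4) b
          (by fun_prop) (by simp [hg0]) (by fun_prop) (by simp [hg0]),
        cfcₙ_sub (fun s => g s * s ^ 4 * g s) (fun s => s ^ 4 * g s) b
          (by fun_prop) (by simp [hg0]) (by fun_prop) (by simp [hg0]),
        cfcₙ_sub (fun s => g s * s ^ 4) (fun s => s ^ 4) b
          (by fun_prop) (by simp [hg0]) (by fun_prop) (by simp),
        ← hga, ← hag, ← hgag, ← hab]
      simp only [CStarModule.inner_sub_left, CStarModule.inner_sub_right,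
        CStarModule.inner_op_smul_left, CStarModule.inner_op_smul_right, hgs, ← ha]
      noncomm_ring
    rw [h2]
    refine norm_cfcₙ_le fun s hs => ?_
    have hp := hden n s
    have h3 : (g s * s ^ 4 * g s - s ^ 4 * g s) - (g s * s ^ 4 - s ^ 4) =
        (s ^ 2 * d n ^ 4 / (s ^ 4 + d n ^ 4)) ^ 2 := by
      simp only [g]
      field_simp
      ring
    rw [h3, norm_pow, Real.norm_eq_abs, abs_of_nonneg (by positivity)]
    gcongr
    rw [div_le_iff₀ hp]
    have h4 : 0 ≤ d n ^ 2 * ((s ^ 2 - d n ^ 2) ^ 2 + s ^ 2 * d n ^ 2) := by positivity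
    nlinarith

end Basic

section Ideal

variable {A : Type*} [NonUnitalCStarAlgebra A] [PartialOrder A]
variable (H : Type*) [NormedAddCommGroup H] [NormedSpace ℂ H] [SMul Aᵐᵒᵖ H] [CStarModule Aᵐᵒᵖ H]

/-- The right Hilbert `A`-module `H` is countably generated: for some sequence of elements `g n`,
the elements `g n <• a`, `a : A`, have dense linear span. -/
def CountablyGenerated : Prop :=
  ∃ g : ℕ → H, Dense (Submodule.span ℂ {x : H | ∃ (n : ℕ) (a : A), x = g n <• a} : Set H)

/-- The submodule `HI` of `H`: the closed linear span of the products `h <• i` with `h : H` and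
`i ∈ I`. For a closed ideal `I` it is the set of these products, see `mem_idealSubmodule_iff`. -/
def idealSubmodule (I : TwoSidedIdeal A) : Submodule ℂ H :=
  (Submodule.span ℂ {x : H | ∃ h : H, ∃ i ∈ I, x = h <• i}).topologicalClosure

variable {H}

theorem smul_mem_idealSubmodule (I : TwoSidedIdeal A) (c : Aᵐᵒᵖ) {x : H}
    (hx : x ∈ idealSubmodule H I) : c • x ∈ idealSubmodule H I := by
  refine map_mem_closure (smulL c).continuous hx fun y hy => ?_
  have hle : Submodule.span ℂ {x : H | ∃ h : H, ∃ i ∈ I, x = h <• i} ≤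
      (Submodule.span ℂ {x : H | ∃ h : H, ∃ i ∈ I, x = h <• i}).comap
        (smulL c : H →L[ℂ] H).toLinearMap := by
    rw [Submodule.span_le]
    rintro _ ⟨h, i, hi, rfl⟩
    refine Submodule.subset_span ⟨h, i * unop c, I.mul_mem_right _ _ hi, ?_⟩
    simp [mul_smul']
  exact hle hy

instance (I : TwoSidedIdeal A) : SMul Aᵐᵒᵖ (idealSubmodule H I) where
  smul c x := ⟨c • (x : H), smul_mem_idealSubmodule I c x.2⟩

/-- `HI` is a Hilbert `A`-module with the inner product of `H`. -/
instance (I : TwoSidedIdeal A) : CStarModule Aᵐᵒᵖ (idealSubmodule H I) where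
  inner x y := ⟪(x : H), (y : H)⟫_(Aᵐᵒᵖ)
  inner_add_right := CStarModule.inner_add_right
  inner_self_nonneg := CStarModule.inner_self_nonneg
  inner_self := CStarModule.inner_self.trans Submodule.coe_eq_zero
  inner_op_smul_right := CStarModule.inner_op_smul_right
  inner_smul_right_complex := CStarModule.inner_smul_right_complex
  star_inner x y := CStarModule.star_inner (x : H) (y : H)
  norm_eq_sqrt_norm_inner_self x := CStarModule.norm_eq_sqrt_norm_inner_self (x : H)

theorem coe_smul_idealSubmodule (I : TwoSidedIdeal A) (c : Aᵐᵒᵖ) (x : idealSubmodule H I) :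
    ((c • x : idealSubmodule H I) : H) = c • (x : H) := rfl

theorem inner_idealSubmodule (I : TwoSidedIdeal A) (x y : idealSubmodule H I) :
    ⟪x, y⟫_(Aᵐᵒᵖ) = ⟪(x : H), (y : H)⟫_(Aᵐᵒᵖ) := rfl

variable [StarOrderedRing A]

theorem inner_mem_of_mem {I : TwoSidedIdeal A} (hI : IsClosed (I : Set A)) {x : H}
    (hx : x ∈ idealSubmodule H I) (z : H) : unop ⟪z, x⟫_(Aᵐᵒᵖ) ∈ I := by
  have hcont : Continuous fun y : H => unop ⟪z, y⟫_(Aᵐᵒᵖ) :=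
    continuous_unop.comp (CStarModule.innerSL (A := Aᵐᵒᵖ) z).continuous
  have hcl : IsClosed {y : H | unop ⟪z, y⟫_(Aᵐᵒᵖ) ∈ I} := hI.preimage hcont
  refine closure_minimal ?_ hcl hx
  intro y hy
  induction hy using Submodule.closure_induction with
  | zero => simp [I.zero_mem]
  | add y w _ _ h1 h2 => simpa using I.add_mem h1 h2
  | smul_mem r y hy =>
    obtain ⟨h, i, hi, rfl⟩ := hy
    rw [← smul_smul_comm' (B := Aᵐᵒᵖ), Set.mem_ofPred_eq, CStarModule.inner_op_smul_right]
    exact I.mul_mem_left _ _ hi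

/-- For a closed two-sided ideal `I`, the elements of `HI` are exactly the products `h <• i`. -/
theorem mem_idealSubmodule_iff [CompleteSpace H] {I : TwoSidedIdeal A} (hI : IsClosed (I : Set A))
    {x : H} : x ∈ idealSubmodule H I ↔ ∃ h : H, ∃ i ∈ I, x = h <• i := by
  constructor
  · intro hx
    obtain ⟨b, y, hb, hy⟩ := exists_factor (B := Aᵐᵒᵖ) x
    refine ⟨y, unop b, ?_, by simpa using hy.symm⟩
    have hcl : IsClosed {c : Aᵐᵒᵖ | unop c ∈ I} := hI.preimage continuous_unop
    refine closure_minimal ?_ hcl hb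
    rintro _ ⟨c, rfl⟩
    exact I.mul_mem_left _ _ (inner_mem_of_mem hI hx x)
  · rintro ⟨h, i, hi, rfl⟩
    exact Submodule.le_topologicalClosure _ (Submodule.subset_span ⟨h, i, hi, rfl⟩)

/-- A two-sided ideal of `A` is `σ`-unital if it has a countable approximate unit: a sequence of
positive contractions in the ideal that is an approximate unit for it. -/
def IsSigmaUnital (I : TwoSidedIdeal A) : Prop :=
  ∃ u : ℕ → A, (∀ n, u n ∈ I ∧ 0 ≤ u n ∧ ‖u n‖ ≤ 1) ∧
    ∀ x ∈ I, Tendsto (fun n => u n * x) atTop (𝓝 x) ∧ Tendsto (fun n => x * u n) atTop (𝓝 x)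

end Ideal

section Iso

variable (A : Type*) [NonUnitalCStarAlgebra A] [PartialOrder A] [StarOrderedRing A]
variable (E F : Type*) [NormedAddCommGroup E] [NormedSpace ℂ E] [SMul Aᵐᵒᵖ E] [CStarModule Aᵐᵒᵖ E]
  [NormedAddCommGroup F] [NormedSpace ℂ F] [SMul Aᵐᵒᵖ F] [CStarModule Aᵐᵒᵖ F]

/-- Isomorphism of right Hilbert `A`-modules: a bijective `A`-linear map that preserves the
`A`-valued inner products. -/
def Isomorphic : Prop :=
  ∃ U : E ≃ₗ[ℂ] F, (∀ (x : E) (a : A), U (x <• a) = U x <• a) ∧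
    ∀ x y : E, ⟪U x, U y⟫_(Aᵐᵒᵖ) = ⟪x, y⟫_(Aᵐᵒᵖ)

end Iso

end RightHilbert

/-!
The vectors of a generating sequence of `HI` give, as a weighted sum of rank one operators, a
positive operator `a` on `H` with range in `HI` and dense range on `HI`; let `b` be such an
operator for `HJ`. The matrix with rows `(a, b)` and `(-b, a)` maps `HI ⊕ HJ` into
`H(I + J) ⊕ H(I ∩ J)`. Over `ℂ` it is diagonalised into `a + ib` and `a - ib`. These have real
part `a`, and the resolvents of an accretive operator show that they have dense range on
`H(I ∩ J)`. It follows that the matrix and its adjoint have dense range, so the polar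
decomposition of the matrix has a unitary part.
-/

namespace RightHilbert

section ScaledResolvent

variable {𝒜 : Type*} [CStarAlgebra 𝒜]

/-- The contractions `t (s + t)⁻¹`, which for an accretive operator `s` (that is,
`0 ≤ s + star s`) and `t → 0+` tend to zero on the closure of the range of `s`. The value is `0` if
`s + t` is not invertible. -/
noncomputable def scaledResolvent (s : 𝒜) (t : ℝ) : 𝒜 := t • Ring.inverse (s + t • 1)

variable {s : 𝒜} {t : ℝ}

theorem mul_inverse_add_smul_one (h : IsUnit (s + t • 1)) :
    s * Ring.inverse (s + t • 1) = 1 - scaledResolvent s t := by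
  rw [scaledResolvent, eq_sub_iff_add_eq, ← smul_one_mul t (Ring.inverse _), ← add_mul,
    Ring.mul_inverse_cancel _ h]

theorem scaledResolvent_conjugate_add (h : IsUnit (s + t • 1)) :
    scaledResolvent s t * (s + star s) * star (scaledResolvent s t) +
        (2 * t) • (scaledResolvent s t * star (scaledResolvent s t)) =
      t • (scaledResolvent s t + star (scaledResolvent s t)) := by
  set r := Ring.inverse (s + t • 1) with hr
  have hrs : r * s = 1 - t • r := by
    rw [eq_sub_iff_add_eq, ← Ring.inverse_mul_cancel _ h, mul_add, mul_smul_one]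
  have hsr : star s * star r = 1 - t • star r := by
    simpa using congrArg star hrs
  have hsum : r * (s + star s) * star r = r + star r - (2 * t) • (r * star r) := by
    rw [mul_add, add_mul, hrs, mul_assoc r, hsr, mul_sub, sub_mul, smul_mul_assoc, mul_smul_comm,
      mul_smul, two_smul]
    noncomm_ring
  simp only [scaledResolvent, ← hr, star_smul, star_trivial, smul_mul_assoc, mul_smul_comm, hsum]
  module

theorem norm_smul_add_star_le (ht : 0 ≤ t) (r : 𝒜) : ‖t • (r + star r)‖ ≤ 2 * t * ‖r‖ :=
  calc ‖t • (r + star r)‖ ≤ t * (‖r‖ + ‖star r‖) := by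
        rw [norm_smul, Real.norm_of_nonneg ht]
        gcongr
        exact norm_add_le _ _
    _ = 2 * t * ‖r‖ := by rw [norm_star]; ring

variable [PartialOrder 𝒜] [StarOrderedRing 𝒜]

theorem isUnit_star_mul_self_add_smul_one (hs : 0 ≤ s + star s) (ht : 0 < t) :
    IsUnit (star (s + t • 1) * (s + t • 1)) := by
  refine CStarAlgebra.isUnit_of_le (t ^ 2 • 1) ?_
    (isStrictlyPositive_one.smul (by positivity))
  have h : star (s + t • 1) * (s + t • 1) = t ^ 2 • 1 + (star s * s + t • (s + star s)) := by
    simp only [star_add, star_smul, star_one, star_trivial, add_mul, mul_add, smul_one_mul,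
      mul_smul_one]
    module
  rw [h]
  exact le_add_of_nonneg_right (add_nonneg (star_mul_self_nonneg s) (smul_nonneg ht.le hs))

theorem isUnit_add_smul_one (hs : 0 ≤ s + star s) (ht : 0 < t) : IsUnit (s + t • 1) := by
  have hstar : star (star s + t • 1) = s + t • 1 := by simp
  have hleft := isUnit_star_mul_self_add_smul_one hs ht
  have hright := isUnit_star_mul_self_add_smul_one (s := star s) (by rwa [star_star, add_comm]) ht
  rw [hstar] at hright
  obtain ⟨c, -, hc⟩ := isUnit_iff_exists.mp hleft
  obtain ⟨b, hb, -⟩ := isUnit_iff_exists.mp hright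
  exact isUnit_iff_exists_and_exists.mpr
    ⟨⟨_, (mul_assoc _ _ _).symm.trans hb⟩, ⟨_, (mul_assoc _ _ _).trans hc⟩⟩

theorem norm_scaledResolvent_le_one (hs : 0 ≤ s + star s) (ht : 0 < t) :
    ‖scaledResolvent s t‖ ≤ 1 := by
  set r := scaledResolvent s t
  have hle : (2 * t) • (r * star r) ≤ t • (r + star r) := by
    rw [← scaledResolvent_conjugate_add (isUnit_add_smul_one hs ht)]
    exact le_add_of_nonneg_left (star_right_conjugate_nonneg hs r)
  have hnorm : 2 * t * (‖r‖ * ‖r‖) ≤ 2 * t * ‖r‖ :=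
    calc 2 * t * (‖r‖ * ‖r‖) = ‖(2 * t) • (r * star r)‖ := by
          rw [norm_smul, CStarRing.norm_self_mul_star, Real.norm_of_nonneg (by positivity)]
      _ ≤ ‖t • (r + star r)‖ := CStarAlgebra.norm_le_norm_of_nonneg_of_le
          (smul_nonneg (by positivity) (mul_star_self_nonneg r)) hle
      _ ≤ 2 * t * ‖r‖ := norm_smul_add_star_le ht.le r
  nlinarith [le_of_mul_le_mul_left hnorm (by positivity), norm_nonneg r]

theorem norm_scaledResolvent_conjugate_le (hs : 0 ≤ s + star s) (ht : 0 < t) :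
    ‖scaledResolvent s t * (s + star s) * star (scaledResolvent s t)‖ ≤ 2 * t := by
  set r := scaledResolvent s t
  have hle : r * (s + star s) * star r ≤ t • (r + star r) := by
    rw [← scaledResolvent_conjugate_add (isUnit_add_smul_one hs ht)]
    exact le_add_of_nonneg_right (smul_nonneg (by positivity) (mul_star_self_nonneg r))
  calc ‖r * (s + star s) * star r‖ ≤ ‖t • (r + star r)‖ :=
        CStarAlgebra.norm_le_norm_of_nonneg_of_le (star_right_conjugate_nonneg hs r) hle
    _ ≤ 2 * t * ‖r‖ := norm_smul_add_star_le ht.le r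
    _ ≤ 2 * t := mul_le_of_le_one_right (by positivity) (norm_scaledResolvent_le_one hs ht)

end ScaledResolvent

section AdjointPair

variable {B E F : Type*} [NonUnitalCStarAlgebra B] [PartialOrder B]
  [NormedAddCommGroup E] [NormedSpace ℂ E] [SMul B E] [CStarModule B E]
  [NormedAddCommGroup F] [NormedSpace ℂ F] [SMul B F] [CStarModule B F]

theorem add_smul' (c d : B) (x : E) : (c + d) • x = c • x + d • x :=
  ext_inner (B := B) fun z => by simp [add_mul]

theorem smul_assoc' (r : ℂ) (c : B) (x : E) : (r • c) • x = r • (c • x) :=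
  ext_inner (B := B) fun z => by simp [smul_mul_assoc]

theorem continuous_smul_const' (x : E) : Continuous fun c : B => c • x :=
  (LipschitzWith.of_dist_le_mul (K := ‖x‖₊) fun c d => by
    rw [dist_eq_norm, dist_eq_norm, ← sub_smul', mul_comm]
    exact norm_smul_le' _ _).continuous

variable (B) in
/-- The maps `S` and `T` between Hilbert C⋆-modules are adjoint to each other. -/
def IsAdjointPair (S : E → F) (T : F → E) : Prop :=
  ∀ x y, ⟪S x, y⟫_B = ⟪x, T y⟫_B

namespace IsAdjointPair

theorem symm {S : E → F} {T : F → E} (h : IsAdjointPair B S T) : IsAdjointPair B T S :=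
  fun x y => by rw [← CStarModule.star_inner, ← h, CStarModule.star_inner]

theorem unique {S : E → F} {T T' : F → E} (h : IsAdjointPair B S T)
    (h' : IsAdjointPair B S T') : T = T' :=
  funext fun y => ext_inner (B := B) fun z => by rw [← h, ← h']

theorem map_smul {S : E → F} {T : F → E} (h : IsAdjointPair B S T) (c : B) (x : E) :
    S (c • x) = c • S x :=
  ext_inner (B := B) fun z => by simp [← h.symm z]

variable [StarOrderedRing B]

theorem continuous [CompleteSpace E] [CompleteSpace F] {S : E →ₗ[ℂ] F} {T : F → E}
    (h : IsAdjointPair B S T) : Continuous S := by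
  refine S.continuous_of_seq_closed_graph fun u x y hu hSu => ext_inner (B := B) fun z => ?_
  rw [← h.symm z]
  refine tendsto_nhds_unique (((CStarModule.innerSL (A := B) z).continuous.tendsto y).comp hSu) ?_
  refine (((CStarModule.innerSL (A := B) (T z)).continuous.tendsto x).comp hu).congr fun n => ?_
  exact h.symm z (u n)

end IsAdjointPair

theorem map_smul_of_inner_eq {U : E ≃ₗ[ℂ] F} (h : ∀ x y, ⟪U x, U y⟫_B = ⟪x, y⟫_B) (c : B) (x : E) :
    U (c • x) = c • U x := by
  have hadj : IsAdjointPair B U U.symm := fun x y => by rw [← h, U.apply_symm_apply]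
  exact hadj.map_smul c x

variable (B E F) [StarOrderedRing B] in
theorem isClosed_setOf_isAdjointPair :
    IsClosed {p : (E →L[ℂ] F) × (F →L[ℂ] E) | IsAdjointPair B p.1 p.2} := by
  simp only [IsAdjointPair, Set.ofPred_forall]
  refine isClosed_iInter fun x => isClosed_iInter fun y => isClosed_eq ?_ ?_
  · exact CStarModule.continuous_inner.comp
      (by fun_prop : Continuous fun p : (E →L[ℂ] F) × (F →L[ℂ] E) => (p.1 x, y))
  · exact CStarModule.continuous_inner.comp
      (by fun_prop : Continuous fun p : (E →L[ℂ] F) × (F →L[ℂ] E) => (x, p.2 y))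

end AdjointPair

section Adjointable

variable (B E : Type*) [NonUnitalCStarAlgebra B] [PartialOrder B]
  [NormedAddCommGroup E] [NormedSpace ℂ E] [SMul B E] [CStarModule B E]

/-- The algebra of bounded operators on a Hilbert C⋆-module that have a bounded adjoint. -/
def Adjointable : Subalgebra ℂ (E →L[ℂ] E) where
  carrier := {S | ∃ T : E →L[ℂ] E, IsAdjointPair B S T}
  mul_mem' := by
    rintro S S' ⟨T, h⟩ ⟨T', h'⟩
    exact ⟨T' * T, fun x y => (h (S' x) y).trans (h' x (T y))⟩
  add_mem' := by
    rintro S S' ⟨T, h⟩ ⟨T', h'⟩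
    exact ⟨T + T', fun x y => by simp [h x y, h' x y]⟩
  algebraMap_mem' r := ⟨algebraMap ℂ _ (star r), fun x y => by
    simp [Algebra.algebraMap_eq_smul_one]⟩

namespace Adjointable

variable {B E}

noncomputable instance : Star (Adjointable B E) where
  star S := ⟨S.2.choose, S, S.2.choose_spec.symm⟩

theorem isAdjointPair_star (S : Adjointable B E) : IsAdjointPair B S.1 (star S).1 :=
  S.2.choose_spec

theorem inner_left (S : Adjointable B E) (x y : E) : ⟪S.1 x, y⟫_B = ⟪x, (star S).1 y⟫_B :=
  isAdjointPair_star S x y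

theorem star_eq_of_isAdjointPair {S T : Adjointable B E} (h : IsAdjointPair B S.1 T.1) :
    star S = T :=
  Subtype.ext <| DFunLike.coe_injective <| (isAdjointPair_star S).unique h

noncomputable instance : StarRing (Adjointable B E) where
  star_involutive S := star_eq_of_isAdjointPair (isAdjointPair_star S).symm
  star_mul S T := star_eq_of_isAdjointPair fun x y =>
    (inner_left S (T.1 x) y).trans (inner_left T x ((star S).1 y))
  star_add S T := star_eq_of_isAdjointPair fun x y => by
    change ⟪S.1 x + T.1 x, y⟫_B = ⟪x, (star S).1 y + (star T).1 y⟫_B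
    simp [inner_left]

noncomputable instance : StarModule ℂ (Adjointable B E) where
  star_smul r S := star_eq_of_isAdjointPair fun x y => by
    change ⟪r • S.1 x, y⟫_B = ⟪x, star r • (star S).1 y⟫_B
    simp [inner_left]

theorem map_smul (S : Adjointable B E) (c : B) (x : E) : S.1 (c • x) = c • S.1 x :=
  (isAdjointPair_star S).map_smul c x

variable [StarOrderedRing B]

instance : CStarRing (Adjointable B E) where
  norm_mul_self_le S := by
    have h : ‖S.1‖ ≤ √‖(star S * S).1‖ := by
      refine ContinuousLinearMap.opNorm_le_bound _ (Real.sqrt_nonneg _) fun x => ?_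
      refine (sq_le_sq₀ (norm_nonneg _) (by positivity)).mp ?_
      rw [mul_pow, Real.sq_sqrt (norm_nonneg _), CStarModule.norm_sq_eq B, inner_left]
      calc ‖⟪x, (star S).1 (S.1 x)⟫_B‖ ≤ ‖x‖ * ‖(star S * S).1 x‖ := CStarModule.norm_inner_le E
        _ ≤ ‖x‖ * (‖(star S * S).1‖ * ‖x‖) := by gcongr; exact (star S * S).1.le_opNorm x
        _ = ‖(star S * S).1‖ * ‖x‖ ^ 2 := by ring
    exact (mul_self_le_mul_self (norm_nonneg S.1) h).trans_eq
      (Real.mul_self_sqrt (norm_nonneg (star S * S).1))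

variable [CompleteSpace E]

instance : CompleteSpace (Adjointable B E) :=
  Metric.complete_of_cauchySeq_tendsto fun u hu => by
    have hstar : CauchySeq fun n => star (u n) :=
      (starₗᵢ ℂ : Adjointable B E ≃ₗᵢ⋆[ℂ] _).isometry.uniformContinuous.comp_cauchySeq hu
    obtain ⟨S, hS⟩ :=
      cauchySeq_tendsto_of_complete (uniformContinuous_subtype_val.comp_cauchySeq hu)
    obtain ⟨T, hT⟩ :=
      cauchySeq_tendsto_of_complete (uniformContinuous_subtype_val.comp_cauchySeq hstar)
    have hST : IsAdjointPair B S T := (isClosed_setOf_isAdjointPair B E E).mem_of_tendsto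
      (hS.prodMk_nhds hT) (Eventually.of_forall fun n => isAdjointPair_star (u n))
    exact ⟨⟨S, T, hST⟩, tendsto_subtype_rng.mpr hS⟩

noncomputable instance : CStarAlgebra (Adjointable B E) where

noncomputable instance : PartialOrder (Adjointable B E) := CStarAlgebra.spectralOrder _

instance : StarOrderedRing (Adjointable B E) := CStarAlgebra.spectralOrderedRing _

theorem nonneg_of_inner_nonneg {P : Adjointable B E} (hP : IsSelfAdjoint P)
    (h : ∀ x, 0 ≤ ⟪x, P.1 x⟫_B) : 0 ≤ P := by
  rw [← CFC.negPart_eq_zero_iff P hP]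
  set N : Adjointable B E := P⁻
  have hN : IsSelfAdjoint N := (CFC.negPart_nonneg P).isSelfAdjoint
  have hPN : P * N = -(N * N) := by
    calc P * N = (P⁺ - N) * N := by rw [CFC.posPart_sub_negPart P hP]
      _ = -(N * N) := by rw [sub_mul, CFC.posPart_mul_negPart, zero_sub]
  set Q : Adjointable B E := CFC.sqrt N * N with hQ
  have hsqrt : CFC.sqrt N * Q = N * N := by
    rw [hQ, ← mul_assoc, CFC.sqrt_mul_sqrt_self N (CFC.negPart_nonneg P)]
  have hQQ : star Q * Q = -(star N * (P * N)) := by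
    rw [hQ, star_mul, (CFC.sqrt_nonneg N).isSelfAdjoint.star_eq, mul_assoc, ← hQ, hsqrt, hPN,
      mul_neg, neg_neg]
  have hQ0 : Q = 0 := Subtype.ext <| ContinuousLinearMap.ext fun x => by
    have hform : ⟪Q.1 x, Q.1 x⟫_B = -⟪N.1 x, P.1 (N.1 x)⟫_B :=
      calc ⟪Q.1 x, Q.1 x⟫_B = ⟪x, (star Q * Q).1 x⟫_B := inner_left Q x _
        _ = -⟪x, (star N).1 (P.1 (N.1 x))⟫_B := by
          rw [hQQ]; exact CStarModule.inner_neg_right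
        _ = -⟪N.1 x, P.1 (N.1 x)⟫_B := by rw [inner_left N]
    exact (CStarModule.inner_self (A := B)).mp <| le_antisymm
      (hform.trans_le (neg_nonpos.mpr (h _))) CStarModule.inner_self_nonneg
  rw [← CStarRing.star_mul_self_eq_zero_iff, hN.star_eq, ← hsqrt, hQ0, mul_zero]

end Adjointable

end Adjointable

section Polar

variable {B E F : Type*} [NonUnitalCStarAlgebra B] [PartialOrder B] [StarOrderedRing B]
  [NormedAddCommGroup E] [NormedSpace ℂ E] [SMul B E] [CStarModule B E] [CompleteSpace E]
  [NormedAddCommGroup F] [NormedSpace ℂ F] [SMul B F] [CStarModule B F] [CompleteSpace F]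

theorem exists_linearEquiv_of_inner_eq {D : Type*} [AddCommGroup D] [Module ℂ D]
    {S : D →ₗ[ℂ] E} {T : D →ₗ[ℂ] F} (hS : DenseRange S) (hT : DenseRange T)
    (h : ∀ x y, ⟪S x, S y⟫_B = ⟪T x, T y⟫_B) :
    ∃ U : E ≃ₗ[ℂ] F, ∀ x y, ⟪U x, U y⟫_B = ⟪x, y⟫_B := by
  have hnorm : ∀ x, ‖S x‖ = ‖T x‖ := fun x => by
    rw [CStarModule.norm_eq_sqrt_norm_inner_self (A := B), h,
      ← CStarModule.norm_eq_sqrt_norm_inner_self]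
  let U : E →L[ℂ] F := T.extendOfNorm S
  let V : F →L[ℂ] E := S.extendOfNorm T
  have hU : ∀ x, U (S x) = T x := fun x =>
    LinearMap.extendOfNorm_eq hS ⟨1, fun x => by simpa using (hnorm x).ge⟩ x
  have hV : ∀ x, V (T x) = S x := fun x =>
    LinearMap.extendOfNorm_eq hT ⟨1, fun x => by simpa using (hnorm x).le⟩ x
  have hVU : ∀ x, V (U x) = x := congrFun <| hS.equalizer (V.comp U).continuous continuous_id <|
    funext fun x => by simp [hU, hV]
  have hUV : ∀ x, U (V x) = x := congrFun <| hT.equalizer (U.comp V).continuous continuous_id <|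
    funext fun x => by simp [hU, hV]
  have hinner : ∀ p : E × E, ⟪U p.1, U p.2⟫_B = ⟪p.1, p.2⟫_B :=
    congrFun <| (hS.prodMap hS).equalizer
      (CStarModule.continuous_inner.comp (by fun_prop : Continuous fun p : E × E => (U p.1, U p.2)))
      CStarModule.continuous_inner <| funext fun p => by simp [hU, h]
  exact ⟨.ofLinearMap U.toLinearMap V.toLinearMap (LinearMap.ext hUV) (LinearMap.ext hVU),
    fun x y => hinner (x, y)⟩

theorem IsAdjointPair.exists_adjointable_inner_eq {T : E →ₗ[ℂ] F} {T' : F →ₗ[ℂ] E}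
    (h : IsAdjointPair B T T') : ∃ Q : Adjointable B E,
      (∀ x, Q.1 (Q.1 x) = T' (T x)) ∧ ∀ x y, ⟪Q.1 x, Q.1 y⟫_B = ⟪T x, T y⟫_B := by
  let P₀ : E →L[ℂ] E := ⟨T' ∘ₗ T, h.symm.continuous.comp h.continuous⟩
  have hP₀ : IsAdjointPair B P₀ P₀ := fun x y => (h.symm (T x) y).trans (h x (T y))
  let P : Adjointable B E := ⟨P₀, P₀, hP₀⟩
  have hP : 0 ≤ P := Adjointable.nonneg_of_inner_nonneg
    (Adjointable.star_eq_of_isAdjointPair hP₀) fun x =>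
      CStarModule.inner_self_nonneg.trans_eq (h x (T x))
  have hQQ : ∀ x, (CFC.sqrt P).1 ((CFC.sqrt P).1 x) = T' (T x) := fun x =>
    congrArg (fun S : Adjointable B E => S.1 x) (CFC.sqrt_mul_sqrt_self P)
  refine ⟨CFC.sqrt P, hQQ, fun x y => ?_⟩
  rw [Adjointable.inner_left, (CFC.sqrt_nonneg P).isSelfAdjoint.star_eq, hQQ, h]

theorem IsAdjointPair.exists_linearEquiv {T : E →ₗ[ℂ] F} {T' : F →ₗ[ℂ] E}
    (h : IsAdjointPair B T T') (hT : DenseRange T) (hT' : DenseRange T') :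
    ∃ U : E ≃ₗ[ℂ] F, ∀ x y, ⟪U x, U y⟫_B = ⟪x, y⟫_B := by
  obtain ⟨Q, hQQ, hQ⟩ := h.exists_adjointable_inner_eq
  refine exists_linearEquiv_of_inner_eq (S := Q.1.toLinearMap) (T := T) ?_ hT hQ
  refine (hT'.comp hT h.symm.continuous).mono ?_
  rintro _ ⟨x, rfl⟩
  exact ⟨Q.1 x, hQQ x⟩

end Polar

section RankOne

variable {B E : Type*} [NonUnitalCStarAlgebra B] [PartialOrder B] [StarOrderedRing B]
  [NormedAddCommGroup E] [NormedSpace ℂ E] [SMul B E] [CStarModule B E]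

theorem norm_inner_smul_le (x w : E) : ‖⟪x, w⟫_B • x‖ ≤ ‖x‖ ^ 2 * ‖w‖ :=
  calc ‖⟪x, w⟫_B • x‖ ≤ ‖⟪x, w⟫_B‖ * ‖x‖ := norm_smul_le' _ _
    _ ≤ ‖x‖ * ‖w‖ * ‖x‖ := by gcongr; exact CStarModule.norm_inner_le E
    _ = ‖x‖ ^ 2 * ‖w‖ := by ring

variable (B) in
/-- The rank one operator `w ↦ ⟪x, w⟫ • x`. -/
noncomputable def rankOne (x : E) : Adjointable B E :=
  let θ : E →L[ℂ] E := LinearMap.mkContinuous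
    { toFun := fun w => ⟪x, w⟫_B • x
      map_add' := fun v w => by rw [CStarModule.inner_add_right, add_smul']
      map_smul' := fun r w => by
        rw [CStarModule.inner_smul_right_complex, smul_assoc', RingHom.id_apply] }
    (‖x‖ ^ 2) (norm_inner_smul_le x)
  have hθ : IsAdjointPair B θ θ := fun v w => by
    change ⟪⟪x, v⟫_B • x, w⟫_B = ⟪v, ⟪x, w⟫_B • x⟫_B
    simp
  ⟨θ, θ, hθ⟩

theorem rankOne_apply (x w : E) : (rankOne B x).1 w = ⟪x, w⟫_B • x := rfl

theorem star_rankOne (x : E) : star (rankOne B x) = rankOne B x :=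
  Adjointable.star_eq_of_isAdjointPair fun v w => by simp [rankOne_apply]

theorem norm_rankOne_le (x : E) : ‖rankOne B x‖ ≤ ‖x‖ ^ 2 :=
  ContinuousLinearMap.opNorm_le_bound _ (sq_nonneg _) (norm_inner_smul_le x)

theorem norm_sq_le_norm_rankOne (x : E) : ‖x‖ ^ 2 ≤ ‖rankOne B x‖ := by
  rcases eq_or_ne x 0 with rfl | hx
  · simpa using norm_nonneg (rankOne B (0 : E))
  refine le_of_mul_le_mul_right ?_ (show 0 < ‖x‖ ^ 2 by positivity)
  calc ‖x‖ ^ 2 * ‖x‖ ^ 2 = ‖⟪(rankOne B x).1 x, x⟫_B‖ := by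
        rw [rankOne_apply, CStarModule.inner_op_smul_left, CStarRing.norm_self_mul_star,
          ← CStarModule.norm_sq_eq B]
    _ ≤ ‖(rankOne B x).1 x‖ * ‖x‖ := CStarModule.norm_inner_le E
    _ ≤ ‖rankOne B x‖ * ‖x‖ * ‖x‖ := by gcongr; exact (rankOne B x).1.le_opNorm x
    _ = ‖rankOne B x‖ * ‖x‖ ^ 2 := by ring

theorem rankOne_map (S : Adjointable B E) (x : E) :
    rankOne B (S.1 x) = S * rankOne B x * star S :=
  Subtype.ext <| ContinuousLinearMap.ext fun w => by
    change ⟪S.1 x, w⟫_B • S.1 x = S.1 (⟪x, (star S).1 w⟫_B • x)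
    rw [Adjointable.inner_left, Adjointable.map_smul]

variable [CompleteSpace E]

theorem rankOne_nonneg (x : E) : 0 ≤ rankOne B x :=
  Adjointable.nonneg_of_inner_nonneg (star_rankOne x) fun w => by
    rw [rankOne_apply, CStarModule.inner_op_smul_right, ← CStarModule.star_inner w x]
    exact star_mul_self_nonneg _

end RankOne

section GramOperator

variable (B : Type*) {E : Type*} [NonUnitalCStarAlgebra B] [PartialOrder B] [StarOrderedRing B]
  [NormedAddCommGroup E] [NormedSpace ℂ E] [SMul B E] [CStarModule B E]

/-- A weighted sum of the rank one operators of the vectors `x n`. It is strictly positive on the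
closed submodule they generate. The weights only serve to make the series converge. -/
noncomputable def gramOperator (x : ℕ → E) : Adjointable B E :=
  ∑' n, ((1 / 2) ^ n / (1 + ‖x n‖ ^ 2) : ℝ) • rankOne B (x n)

variable {B} [CompleteSpace E]

theorem hasSum_gramOperator (x : ℕ → E) :
    HasSum (fun n => ((1 / 2) ^ n / (1 + ‖x n‖ ^ 2) : ℝ) • rankOne B (x n)) (gramOperator B x) := by
  refine (Summable.of_norm_bounded summable_geometric_two fun n => ?_).hasSum
  rw [norm_smul, Real.norm_of_nonneg (by positivity), div_mul_eq_mul_div,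
    div_le_iff₀ (by positivity)]
  gcongr
  linarith [norm_rankOne_le (B := B) (x n)]

theorem gramOperator_nonneg (x : ℕ → E) : 0 ≤ gramOperator B x :=
  tsum_nonneg fun n => smul_nonneg (by positivity) (rankOne_nonneg (x n))

theorem exists_rankOne_le_smul_gramOperator (x : ℕ → E) (n : ℕ) :
    ∃ C : ℝ, rankOne B (x n) ≤ C • gramOperator B x :=
  ⟨((1 / 2) ^ n / (1 + ‖x n‖ ^ 2))⁻¹, (le_inv_smul_iff_of_pos (by positivity)).mpr <|
    le_hasSum (hasSum_gramOperator x) n fun m _ =>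
      smul_nonneg (by positivity) (rankOne_nonneg (x m))⟩

theorem gramOperator_apply_mem {x : ℕ → E} {V : Submodule ℂ E} (hV : IsClosed (V : Set E)) {w : E}
    (h : ∀ n, ⟪x n, w⟫_B • x n ∈ V) : (gramOperator B x).1 w ∈ V := by
  have hsum := ((hasSum_gramOperator (B := B) x).map (Adjointable B E).subtype
    continuous_subtype_val).map (ContinuousLinearMap.apply ℂ E w)
    (ContinuousLinearMap.apply ℂ E w).continuous
  exact hV.mem_of_tendsto hsum <| Eventually.of_forall fun s =>
    V.sum_mem fun n _ => V.smul_of_tower_mem _ (h n)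

end GramOperator

theorem isClosed_setOf_tendsto_zero {𝕜 X Y ι : Type*} [NontriviallyNormedField 𝕜]
    [NormedAddCommGroup X] [NormedSpace 𝕜 X] [NormedAddCommGroup Y] [NormedSpace 𝕜 Y] {l : Filter ι}
    {T : ι → X →L[𝕜] Y} (hT : ∀ᶠ i in l, ‖T i‖ ≤ 1) :
    IsClosed {x | Tendsto (fun i => T i x) l (𝓝 0)} := by
  refine isClosed_of_closure_subset fun x hx => Metric.tendsto_nhds.mpr fun ε hε => ?_
  obtain ⟨y, hy, hxy⟩ := Metric.mem_closure_iff.mp hx (ε / 2) (half_pos hε)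
  filter_upwards [hT, Metric.tendsto_nhds.mp hy (ε / 2) (half_pos hε)] with i hi hiy
  rw [dist_zero_right] at hiy ⊢
  calc ‖T i x‖ = ‖T i (x - y) + T i y‖ := by rw [map_sub, sub_add_cancel]
    _ ≤ ‖T i (x - y)‖ + ‖T i y‖ := norm_add_le _ _
    _ ≤ 1 * ‖x - y‖ + ‖T i y‖ := by gcongr; exact (T i).le_of_opNorm_le hi _
    _ < ε := by rw [dist_eq_norm] at hxy; linarith

/-- The closed submodule generated by a sequence of vectors. -/
def generatedSubmodule (B : Type*) {E : Type*} [SMul B E] [NormedAddCommGroup E] [NormedSpace ℂ E]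
    (x : ℕ → E) : Submodule ℂ E :=
  (Submodule.span ℂ {y | ∃ (n : ℕ) (c : B), y = c • x n}).topologicalClosure

section Resolvent

variable {B E : Type*} [NonUnitalCStarAlgebra B] [PartialOrder B] [StarOrderedRing B]
  [NormedAddCommGroup E] [NormedSpace ℂ E] [SMul B E] [CStarModule B E] [CompleteSpace E]

theorem norm_sq_scaledResolvent_apply_le {S : Adjointable B E} (hS : 0 ≤ S + star S) {x : E} {C : ℝ}
    (hx : rankOne B x ≤ C • (S + star S)) {t : ℝ} (ht : 0 < t) :
    ‖(scaledResolvent S t).1 x‖ ^ 2 ≤ |C| * (2 * t) := by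
  set R := scaledResolvent S t
  have hle : rankOne B (R.1 x) ≤ C • (R * (S + star S) * star R) := by
    rw [rankOne_map, ← smul_mul_assoc, ← mul_smul_comm]
    exact star_right_conjugate_le_conjugate hx R
  calc ‖R.1 x‖ ^ 2 ≤ ‖rankOne B (R.1 x)‖ := norm_sq_le_norm_rankOne _
    _ ≤ ‖C • (R * (S + star S) * star R)‖ :=
        CStarAlgebra.norm_le_norm_of_nonneg_of_le (rankOne_nonneg _) hle
    _ = |C| * ‖R * (S + star S) * star R‖ := by rw [norm_smul, Real.norm_eq_abs]
    _ ≤ |C| * (2 * t) := by gcongr; exact norm_scaledResolvent_conjugate_le hS ht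

theorem tendsto_scaledResolvent_apply {S : Adjointable B E} (hS : 0 ≤ S + star S) {x : E} {C : ℝ}
    (hx : rankOne B x ≤ C • (S + star S)) :
    Tendsto (fun t => (scaledResolvent S t).1 x) (𝓝[>] 0) (𝓝 0) := by
  rw [tendsto_zero_iff_norm_tendsto_zero]
  have hbound : Tendsto (fun t : ℝ => √(|C| * (2 * t))) (𝓝[>] 0) (𝓝 0) := by
    have : Continuous fun t : ℝ => √(|C| * (2 * t)) := by fun_prop
    simpa using (this.tendsto 0).mono_left nhdsWithin_le_nhds
  refine squeeze_zero' (Eventually.of_forall fun _ => norm_nonneg _) ?_ hbound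
  filter_upwards [self_mem_nhdsWithin] with t ht
  exact Real.le_sqrt_of_sq_le (norm_sq_scaledResolvent_apply_le hS hx ht)

theorem tendsto_scaledResolvent_apply_of_mem {S : Adjointable B E} (hS : 0 ≤ S + star S)
    {x : ℕ → E} (hx : ∀ n, ∃ C : ℝ, rankOne B (x n) ≤ C • (S + star S)) {y : E}
    (hy : y ∈ generatedSubmodule B x) :
    Tendsto (fun t => (scaledResolvent S t).1 y) (𝓝[>] 0) (𝓝 0) := by
  have hnorm : ∀ᶠ t in 𝓝[>] (0 : ℝ), ‖(scaledResolvent S t).1‖ ≤ 1 := by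
    filter_upwards [self_mem_nhdsWithin] with t ht
    exact norm_scaledResolvent_le_one hS ht
  refine closure_minimal (fun y hy => ?_) (isClosed_setOf_tendsto_zero hnorm) hy
  induction hy using Submodule.span_induction with
  | mem y hy =>
    obtain ⟨n, c, rfl⟩ := hy
    obtain ⟨C, hC⟩ := hx n
    have hlim := ((smulL c : E →L[ℂ] E).continuous.tendsto 0).comp
      (tendsto_scaledResolvent_apply hS hC)
    rw [map_zero] at hlim
    simpa [Function.comp_def, Adjointable.map_smul] using hlim
  | zero => simp
  | add y z _ _ hy hz => simpa using hy.add hz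
  | smul r y _ hy => simpa using hy.const_smul r

theorem le_topologicalClosure_map_of_le_generatedSubmodule {S : Adjointable B E}
    (hS : 0 ≤ S + star S) {x : ℕ → E}
    (hx : ∀ n, ∃ C : ℝ, rankOne B (x n) ≤ C • (S + star S)) {V : Submodule ℂ E}
    (hV : ∀ (R : Adjointable B E), ∀ v ∈ V, R.1 v ∈ V) (hVx : V ≤ generatedSubmodule B x) :
    V ≤ (V.map S.1.toLinearMap).topologicalClosure := fun y hy => by
  have hlim : Tendsto (fun t => y - (scaledResolvent S t).1 y) (𝓝[>] 0) (𝓝 y) := by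
    simpa using tendsto_const_nhds.sub (tendsto_scaledResolvent_apply_of_mem hS hx (hVx hy))
  refine mem_closure_of_tendsto hlim ?_
  filter_upwards [self_mem_nhdsWithin] with t ht
  refine ⟨(Ring.inverse (S + t • 1)).1 y, hV _ y hy, ?_⟩
  exact congrArg (fun T : Adjointable B E => T.1 y)
    (mul_inverse_add_smul_one (isUnit_add_smul_one hS ht))

theorem le_topologicalClosure_map_gramOperator_add {x : ℕ → E} {b : Adjointable B E}
    (hb : IsSelfAdjoint b) {z : ℂ} (hz : star z = -z) {V : Submodule ℂ E}
    (hV : ∀ (R : Adjointable B E), ∀ v ∈ V, R.1 v ∈ V) (hVx : V ≤ generatedSubmodule B x) :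
    V ≤ (V.map (gramOperator B x + z • b).1.toLinearMap).topologicalClosure := by
  have hadd : (gramOperator B x + z • b) + star (gramOperator B x + z • b) =
      (2 : ℝ) • gramOperator B x := by
    rw [star_add, star_smul, hz, hb.star_eq, (gramOperator_nonneg x).isSelfAdjoint.star_eq]
    module
  refine le_topologicalClosure_map_of_le_generatedSubmodule (x := x) ?_ (fun n => ?_) hV hVx
  · rw [hadd]
    exact smul_nonneg zero_le_two (gramOperator_nonneg x)
  · obtain ⟨C, hC⟩ := exists_rankOne_le_smul_gramOperator (B := B) x n
    refine ⟨C / 2, ?_⟩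
    rwa [hadd, smul_smul, div_mul_cancel₀ C two_ne_zero]

end Resolvent

section IdealSubmodule

variable {A : Type*} [NonUnitalCStarAlgebra A]
  {H : Type*} [NormedAddCommGroup H] [NormedSpace ℂ H] [SMul Aᵐᵒᵖ H] {I J : TwoSidedIdeal A}

theorem smul_mem_idealSubmodule_of_mem (h : H) {i : A} (hi : i ∈ I) :
    h <• i ∈ idealSubmodule H I :=
  Submodule.le_topologicalClosure _ (Submodule.subset_span ⟨h, i, hi, rfl⟩)

theorem idealSubmodule_le {V : Submodule ℂ H} (hV : IsClosed (V : Set H))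
    (h : ∀ x : H, ∀ i ∈ I, x <• i ∈ V) : idealSubmodule H I ≤ V :=
  Submodule.topologicalClosure_minimal _
    (Submodule.span_le.mpr fun _ ⟨x, i, hi, hx⟩ => hx ▸ h x i hi) hV

theorem isClosed_idealSubmodule (I : TwoSidedIdeal A) : IsClosed (idealSubmodule H I : Set H) :=
  Submodule.isClosed_topologicalClosure _

theorem idealSubmodule_mono (h : I ≤ J) : idealSubmodule H I ≤ idealSubmodule H J :=
  idealSubmodule_le (isClosed_idealSubmodule J) fun x _ hi =>
    smul_mem_idealSubmodule_of_mem x (h hi)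

variable [PartialOrder A] [CStarModule Aᵐᵒᵖ H]

theorem idealSubmodule_sup (I J : TwoSidedIdeal A) :
    idealSubmodule H (I ⊔ J) = (idealSubmodule H I ⊔ idealSubmodule H J).topologicalClosure := by
  refine le_antisymm (idealSubmodule_le (Submodule.isClosed_topologicalClosure _) fun x k hk => ?_)
    (Submodule.topologicalClosure_minimal _ (sup_le (idealSubmodule_mono le_sup_left)
      (idealSubmodule_mono le_sup_right)) (isClosed_idealSubmodule _))
  obtain ⟨i, hi, j, hj, rfl⟩ := TwoSidedIdeal.mem_sup.mp hk
  rw [op_add, add_smul']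
  exact Submodule.le_topologicalClosure _ <| Submodule.add_mem_sup
    (smul_mem_idealSubmodule_of_mem x hi) (smul_mem_idealSubmodule_of_mem x hj)

theorem Adjointable.map_mem_idealSubmodule (S : Adjointable Aᵐᵒᵖ H) {x : H}
    (hx : x ∈ idealSubmodule H I) : S.1 x ∈ idealSubmodule H I := by
  have hle : idealSubmodule H I ≤ (idealSubmodule H I).comap S.1.toLinearMap :=
    idealSubmodule_le ((isClosed_idealSubmodule I).preimage S.1.continuous) fun h i hi => by
      rw [Submodule.mem_comap, ContinuousLinearMap.coe_coe, Adjointable.map_smul]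
      exact smul_mem_idealSubmodule_of_mem _ hi
  exact hle hx

variable [StarOrderedRing A]

theorem inner_smul_self_mem_idealSubmodule_inf {x w : H} (hx : x ∈ idealSubmodule H I)
    (hw : w ∈ idealSubmodule H J) : ⟪x, w⟫_(Aᵐᵒᵖ) • x ∈ idealSubmodule H (I ⊓ J) := by
  have hsmul : ∀ j ∈ J, x <• j ∈ idealSubmodule H (I ⊓ J) := fun j hj => by
    have hle : idealSubmodule H I ≤
        (idealSubmodule H (I ⊓ J)).comap (smulL (op j) : H →L[ℂ] H).toLinearMap :=
      idealSubmodule_le ((isClosed_idealSubmodule _).preimage (smulL (op j)).continuous)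
        fun h i hi => by
          rw [Submodule.mem_comap, ContinuousLinearMap.coe_coe, smulL_apply, ← mul_smul', ← op_mul]
          exact smul_mem_idealSubmodule_of_mem h ⟨I.mul_mem_right _ _ hi, J.mul_mem_left _ _ hj⟩
    exact hle hx
  have hle : idealSubmodule H J ≤
      (idealSubmodule H (I ⊓ J)).comap (rankOne Aᵐᵒᵖ x).1.toLinearMap :=
    idealSubmodule_le ((isClosed_idealSubmodule _).preimage (rankOne Aᵐᵒᵖ x).1.continuous)
      fun h j hj => by
        have hinner : ⟪x, h <• j⟫_(Aᵐᵒᵖ) = op (unop ⟪x, h⟫_(Aᵐᵒᵖ) * j) := by simp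
        rw [Submodule.mem_comap, ContinuousLinearMap.coe_coe, rankOne_apply, hinner]
        exact hsmul _ (J.mul_mem_left _ _ hj)
  exact hle hw

end IdealSubmodule

section CountablyGenerated

variable {A : Type*} [NonUnitalCStarAlgebra A] [PartialOrder A]
  {H : Type*} [NormedAddCommGroup H] [NormedSpace ℂ H] [SMul Aᵐᵒᵖ H] [CStarModule Aᵐᵒᵖ H]
  {I : TwoSidedIdeal A}

theorem countablyGenerated_idealSubmodule_iff :
    CountablyGenerated (A := A) (idealSubmodule H I) ↔
      ∃ x : ℕ → idealSubmodule H I,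
        idealSubmodule H I ≤ generatedSubmodule Aᵐᵒᵖ fun n => (x n : H) := by
  refine exists_congr fun x => Subtype.dense_iff.trans ?_
  have himage : (idealSubmodule H I).subtype '' {y | ∃ (n : ℕ) (a : A), y = x n <• a} =
      {y : H | ∃ (n : ℕ) (c : Aᵐᵒᵖ), y = c • (x n : H)} := by
    ext y
    constructor
    · rintro ⟨_, ⟨n, a, rfl⟩, rfl⟩
      exact ⟨n, op a, rfl⟩
    · rintro ⟨n, c, rfl⟩
      exact ⟨c • x n, ⟨n, unop c, rfl⟩, rfl⟩
  rw [generatedSubmodule, ← himage, ← Submodule.map_span]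
  rfl

theorem idealSubmodule_le_of_dense {g : ℕ → H}
    (hg : Dense (Submodule.span ℂ {x : H | ∃ (n : ℕ) (a : A), x = g n <• a} : Set H))
    {V : Submodule ℂ H} (hV : IsClosed (V : Set H)) (h : ∀ n, ∀ i ∈ I, g n <• i ∈ V) :
    idealSubmodule H I ≤ V := by
  refine idealSubmodule_le hV fun x i hi => ?_
  have hspan : Submodule.span ℂ {x : H | ∃ (n : ℕ) (a : A), x = g n <• a} ≤
      V.comap (smulL (op i) : H →L[ℂ] H).toLinearMap := by
    rw [Submodule.span_le]
    rintro _ ⟨n, a, rfl⟩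
    have hmem : g n <• (a * i) ∈ V := h n _ (I.mul_mem_left _ _ hi)
    rwa [op_mul, mul_smul'] at hmem
  exact closure_minimal hspan (hV.preimage (smulL (op i) : H →L[ℂ] H).continuous) (hg x)

theorem countablyGenerated_idealSubmodule (hI : IsSigmaUnital I)
    (hH : CountablyGenerated (A := A) H) : CountablyGenerated (A := A) (idealSubmodule H I) := by
  obtain ⟨u, hu, hlim⟩ := hI
  obtain ⟨g, hg⟩ := hH
  let x : ℕ → idealSubmodule H I := fun n =>
    ⟨g n.unpair.1 <• u n.unpair.2, smul_mem_idealSubmodule_of_mem _ (hu _).1⟩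
  refine countablyGenerated_idealSubmodule_iff.mpr ⟨x, ?_⟩
  have hclosed := Submodule.isClosed_topologicalClosure
    (Submodule.span ℂ {y | ∃ (n : ℕ) (c : Aᵐᵒᵖ), y = c • (x n : H)})
  refine idealSubmodule_le_of_dense hg hclosed fun n i hi => ?_
  have htendsto : Tendsto (fun m => g n <• (u m * i)) atTop (𝓝 (g n <• i)) :=
    ((continuous_smul_const' (B := Aᵐᵒᵖ) (g n)).comp continuous_op).continuousAt.tendsto.comp
      (hlim i hi).1
  refine hclosed.mem_of_tendsto htendsto (Eventually.of_forall fun m => ?_)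
  refine Submodule.le_topologicalClosure _ (Submodule.subset_span ⟨Nat.pair n m, op i, ?_⟩)
  simp only [x, Nat.unpair_pair, op_mul, mul_smul']

end CountablyGenerated

section Rotation

variable {E : Type*} [NormedAddCommGroup E] [NormedSpace ℂ E]

/-- The operator matrix with rows `(a, b)` and `(-b, a)`. For self-adjoint `a` and `b` its adjoint
is `rotation a (-b)`. -/
def rotation (a b : E →L[ℂ] E) : E × E →L[ℂ] E × E :=
  (a.comp (.fst ℂ E E) + b.comp (.snd ℂ E E)).prod (a.comp (.snd ℂ E E) - b.comp (.fst ℂ E E))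

/-- The closure of the image of `p × q` under `rotation a b`. -/
def rotationRange (a b : E →L[ℂ] E) (p q : Submodule ℂ E) : Submodule ℂ (E × E) :=
  ((p.prod q).map (rotation a b).toLinearMap).topologicalClosure

variable {a b : E →L[ℂ] E} {p q l s : Submodule ℂ E}

theorem rotation_mem_rotationRange {v w : E} (hv : v ∈ p) (hw : w ∈ q) :
    (a v + b w, a w - b v) ∈ rotationRange a b p q :=
  Submodule.le_topologicalClosure _ ⟨(v, w), ⟨hv, hw⟩, rfl⟩

theorem rotationRange_mono (hp : l ≤ p) (hq : s ≤ q) :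
    rotationRange a b l s ≤ rotationRange a b p q :=
  Submodule.topologicalClosure_mono (Submodule.map_mono (Submodule.prod_mono hp hq))

theorem map_mem_rotationRange_of_le_topologicalClosure_map {f : E →L[ℂ] E × E} {T : E →L[ℂ] E}
    (hl : l ≤ (l.map T.toLinearMap).topologicalClosure)
    (h : ∀ v ∈ l, f (T v) ∈ rotationRange a b p q) :
    ∀ v ∈ l, f v ∈ rotationRange a b p q := by
  have hle : (l.map T.toLinearMap).topologicalClosure ≤
      (rotationRange a b p q).comap f.toLinearMap :=
    Submodule.topologicalClosure_minimal _ (Submodule.map_le_iff_le_comap.mpr h)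
      ((Submodule.isClosed_topologicalClosure _).preimage f.continuous)
  exact fun v hv => hle (hl hv)

/- Over `ℂ` the matrix `rotation a b` is diagonalised by the vectors `(v, z • v)` with `z = ± i`:
it maps `(v, z • v)` to `(w, z • w)` with `w = a v + z • b v`. -/
theorem prod_self_le_rotationRange
    (h : ∀ z : ℂ, star z = -z → l ≤ (l.map (a + z • b).toLinearMap).topologicalClosure) :
    l.prod l ≤ rotationRange a b l l := by
  have hgraph : ∀ z : ℂ, star z = -z → z * z = -1 →
      ∀ v ∈ l, (v, z • v) ∈ rotationRange a b l l := fun z hz hzz => by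
    refine map_mem_rotationRange_of_le_topologicalClosure_map
      (f := (ContinuousLinearMap.id ℂ E).prod (z • ContinuousLinearMap.id ℂ E)) (h z hz)
      fun v hv => ?_
    convert rotation_mem_rotationRange (a := a) (b := b) hv (l.smul_mem z hv) using 1
    ext
    · simp
    · simp [smul_smul, hzz, sub_eq_add_neg]
  rintro ⟨x, y⟩ ⟨hx, hy⟩
  have hu := hgraph Complex.I (by simp) Complex.I_mul_I _
    (l.smul_mem (2⁻¹ : ℂ) (l.sub_mem hx (l.smul_mem Complex.I hy)))
  have hw := hgraph (-Complex.I) (by simp) (by simp) _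
    (l.smul_mem (2⁻¹ : ℂ) (l.add_mem hx (l.smul_mem Complex.I hy)))
  convert Submodule.add_mem _ hu hw using 1
  ext
  · simp only [Prod.fst_add]
    module
  · simp only [Prod.snd_add, smul_sub, smul_add, smul_smul, mul_comm Complex.I,
      mul_neg, neg_mul, mul_assoc, Complex.I_mul_I]
    module

theorem topologicalClosure_sup_prod_le_rotationRange
    (hp : p ≤ (p.map a.toLinearMap).topologicalClosure)
    (hq : q ≤ (q.map b.toLinearMap).topologicalClosure)
    (ha : ∀ v ∈ q, a v ∈ l) (hb : ∀ v ∈ p, b v ∈ l) (hl : l.prod l ≤ rotationRange a b p q) :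
    (p ⊔ q).topologicalClosure.prod l ≤ rotationRange a b p q := by
  have hinr : ∀ v ∈ l, ((0 : E), v) ∈ rotationRange a b p q := fun v hv => hl ⟨l.zero_mem, hv⟩
  have hpinl : ∀ v ∈ p, (v, (0 : E)) ∈ rotationRange a b p q :=
    map_mem_rotationRange_of_le_topologicalClosure_map (f := .inl ℂ E E) hp fun v hv => by
      simpa using Submodule.add_mem _
        (rotation_mem_rotationRange (a := a) (b := b) hv q.zero_mem) (hinr _ (hb v hv))
  have hqinl : ∀ v ∈ q, (v, (0 : E)) ∈ rotationRange a b p q :=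
    map_mem_rotationRange_of_le_topologicalClosure_map (f := .inl ℂ E E) hq fun v hv => by
      simpa using Submodule.sub_mem _
        (rotation_mem_rotationRange (a := a) (b := b) p.zero_mem hv) (hinr _ (ha v hv))
  have hclosed : IsClosed (rotationRange a b p q : Set (E × E)) :=
    Submodule.isClosed_topologicalClosure _
  refine (Submodule.prod_le_iff _ _ _).mpr ⟨Submodule.map_le_iff_le_comap.mpr ?_,
    Submodule.map_le_iff_le_comap.mpr hinr⟩
  exact Submodule.topologicalClosure_minimal _ (sup_le hpinl hqinl)
    (hclosed.preimage (ContinuousLinearMap.inl ℂ E E).continuous)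

theorem prod_le_rotationRange_neg (hps : p ≤ s) (hqs : q ≤ s)
    (hp : p ≤ (p.map a.toLinearMap).topologicalClosure)
    (hq : q ≤ (q.map b.toLinearMap).topologicalClosure)
    (ha : ∀ v ∈ q, a v ∈ l) (hb : ∀ v ∈ p, b v ∈ l) (hl : l.prod l ≤ rotationRange a (-b) s l) :
    p.prod q ≤ rotationRange a (-b) s l := by
  have hmem : ∀ v ∈ s, (a v, b v) ∈ rotationRange a (-b) s l := fun v hv => by
    simpa using rotation_mem_rotationRange (a := a) (b := -b) hv l.zero_mem
  have hinl : ∀ v ∈ l, (v, (0 : E)) ∈ rotationRange a (-b) s l := fun v hv => hl ⟨hv, l.zero_mem⟩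
  have hinr : ∀ v ∈ l, ((0 : E), v) ∈ rotationRange a (-b) s l := fun v hv => hl ⟨l.zero_mem, hv⟩
  refine (Submodule.prod_le_iff _ _ _).mpr ⟨Submodule.map_le_iff_le_comap.mpr ?_,
    Submodule.map_le_iff_le_comap.mpr ?_⟩
  · exact map_mem_rotationRange_of_le_topologicalClosure_map (f := .inl ℂ E E) hp fun v hv => by
      simpa using Submodule.sub_mem _ (hmem v (hps hv)) (hinr _ (hb v hv))
  · exact map_mem_rotationRange_of_le_topologicalClosure_map (f := .inr ℂ E E) hq fun v hv => by
      simpa using Submodule.sub_mem _ (hmem v (hqs hv)) (hinl _ (ha v hv))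

end Rotation

section RotationMap

variable {A : Type*} [NonUnitalCStarAlgebra A]
  {H : Type*} [NormedAddCommGroup H] [NormedSpace ℂ H] [SMul Aᵐᵒᵖ H]
  {I J K L : TwoSidedIdeal A}

/-- The restriction of `rotation a b` to an operator between direct sums of submodules `HK`. -/
noncomputable def rotationMap (a b : H →L[ℂ] H)
    (h : (idealSubmodule H I).prod (idealSubmodule H J) ≤
      ((idealSubmodule H K).prod (idealSubmodule H L)).comap (rotation a b).toLinearMap) :
    C⋆ᵐᵒᵈ(Aᵐᵒᵖ, idealSubmodule H I × idealSubmodule H J) →ₗ[ℂ]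
      C⋆ᵐᵒᵈ(Aᵐᵒᵖ, idealSubmodule H K × idealSubmodule H L) :=
  let T := (rotation a b).toLinearMap ∘ₗ
    (idealSubmodule H I).subtype.prodMap (idealSubmodule H J).subtype
  (WithCStarModule.linearEquiv ℂ Aᵐᵒᵖ _).symm.toLinearMap ∘ₗ
    ((LinearMap.fst ℂ H H ∘ₗ T).codRestrict _ fun x => (h ⟨x.1.2, x.2.2⟩).1).prod
      ((LinearMap.snd ℂ H H ∘ₗ T).codRestrict _ fun x => (h ⟨x.1.2, x.2.2⟩).2) ∘ₗ
        (WithCStarModule.linearEquiv ℂ Aᵐᵒᵖ _).toLinearMap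

theorem denseRange_rotationMap {a b : H →L[ℂ] H}
    (h : (idealSubmodule H I).prod (idealSubmodule H J) ≤
      ((idealSubmodule H K).prod (idealSubmodule H L)).comap (rotation a b).toLinearMap)
    (hKL : (idealSubmodule H K).prod (idealSubmodule H L) ≤
      rotationRange a b (idealSubmodule H I) (idealSubmodule H J)) :
    DenseRange (rotationMap a b h) := by
  let ι : C⋆ᵐᵒᵈ(Aᵐᵒᵖ, idealSubmodule H K × idealSubmodule H L) → H × H :=
    fun x => ((x.1 : H), (x.2 : H))
  have hι : Topology.IsInducing ι :=
    (Topology.IsInducing.subtypeVal.prodMap Topology.IsInducing.subtypeVal).comp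
      (WithCStarModule.uniformEquiv (A := Aᵐᵒᵖ)
        (E := idealSubmodule H K × idealSubmodule H L)).isUniformInducing.isInducing
  intro x
  rw [hι.closure_eq_preimage_closure_image]
  refine closure_mono ?_ (hKL ⟨x.1.2, x.2.2⟩)
  rintro _ ⟨⟨v, w⟩, ⟨hv, hw⟩, rfl⟩
  exact ⟨_, ⟨(WithCStarModule.equiv _ _).symm (⟨v, hv⟩, ⟨w, hw⟩), rfl⟩, rfl⟩

variable [PartialOrder A] [StarOrderedRing A] [CStarModule Aᵐᵒᵖ H]

theorem isAdjointPair_rotationMap {a b : Adjointable Aᵐᵒᵖ H}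
    (ha : IsSelfAdjoint a) (hb : IsSelfAdjoint b)
    (h : (idealSubmodule H I).prod (idealSubmodule H J) ≤
      ((idealSubmodule H K).prod (idealSubmodule H L)).comap (rotation a.1 b.1).toLinearMap)
    (h' : (idealSubmodule H K).prod (idealSubmodule H L) ≤
      ((idealSubmodule H I).prod (idealSubmodule H J)).comap (rotation a.1 (-b.1)).toLinearMap) :
    IsAdjointPair Aᵐᵒᵖ (rotationMap a.1 b.1 h) (rotationMap a.1 (-b.1) h') := by
  intro x y
  change ⟪a.1 x.1 + b.1 x.2, (y.1 : H)⟫_(Aᵐᵒᵖ) + ⟪a.1 x.2 - b.1 x.1, (y.2 : H)⟫_(Aᵐᵒᵖ) =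
    ⟪(x.1 : H), a.1 y.1 + -b.1 y.2⟫_(Aᵐᵒᵖ) + ⟪(x.2 : H), a.1 y.2 - -b.1 y.1⟫_(Aᵐᵒᵖ)
  simp only [CStarModule.inner_add_left, CStarModule.inner_add_right, CStarModule.inner_sub_left,
    CStarModule.inner_sub_right, CStarModule.inner_neg_right, Adjointable.inner_left,
    ha.star_eq, hb.star_eq]
  abel

end RotationMap

section Isomorphism

variable {A : Type*} [NonUnitalCStarAlgebra A] [PartialOrder A] [StarOrderedRing A]
  {H : Type*} [NormedAddCommGroup H] [NormedSpace ℂ H] [CompleteSpace H] [SMul Aᵐᵒᵖ H]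
  [CStarModule Aᵐᵒᵖ H] {I J : TwoSidedIdeal A}

theorem isomorphic_of_denseRange {E F : Type*}
    [NormedAddCommGroup E] [NormedSpace ℂ E] [SMul Aᵐᵒᵖ E] [CStarModule Aᵐᵒᵖ E] [CompleteSpace E]
    [NormedAddCommGroup F] [NormedSpace ℂ F] [SMul Aᵐᵒᵖ F] [CStarModule Aᵐᵒᵖ F] [CompleteSpace F]
    {T : E →ₗ[ℂ] F} {T' : F →ₗ[ℂ] E} (h : IsAdjointPair Aᵐᵒᵖ T T')
    (hT : DenseRange T) (hT' : DenseRange T') : Isomorphic A E F := by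
  obtain ⟨U, hU⟩ := h.exists_linearEquiv hT hT'
  exact ⟨U, fun x c => map_smul_of_inner_eq hU (op c) x, hU⟩

theorem isomorphic_prod_sup_inf {a b : Adjointable Aᵐᵒᵖ H}
    (ha : IsSelfAdjoint a) (hb : IsSelfAdjoint b)
    (haI : ∀ v, a.1 v ∈ idealSubmodule H I) (hbJ : ∀ v, b.1 v ∈ idealSubmodule H J)
    (haJ : ∀ v ∈ idealSubmodule H J, a.1 v ∈ idealSubmodule H (I ⊓ J))
    (hbI : ∀ v ∈ idealSubmodule H I, b.1 v ∈ idealSubmodule H (I ⊓ J))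
    (ha_dense : idealSubmodule H I ≤
      ((idealSubmodule H I).map a.1.toLinearMap).topologicalClosure)
    (hb_dense : idealSubmodule H J ≤
      ((idealSubmodule H J).map b.1.toLinearMap).topologicalClosure)
    (h_dense : ∀ z : ℂ, star z = -z → idealSubmodule H (I ⊓ J) ≤
      ((idealSubmodule H (I ⊓ J)).map (a.1 + z • b.1).toLinearMap).topologicalClosure) :
    Isomorphic A C⋆ᵐᵒᵈ(Aᵐᵒᵖ, idealSubmodule H I × idealSubmodule H J)
      C⋆ᵐᵒᵈ(Aᵐᵒᵖ, idealSubmodule H (I ⊔ J) × idealSubmodule H (I ⊓ J)) := by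
  have hcomplete (K : TwoSidedIdeal A) : CompleteSpace (idealSubmodule H K) :=
    (isClosed_idealSubmodule K).completeSpace_coe
  have hIsup : idealSubmodule H I ≤ idealSubmodule H (I ⊔ J) := idealSubmodule_mono le_sup_left
  have hJsup : idealSubmodule H J ≤ idealSubmodule H (I ⊔ J) := idealSubmodule_mono le_sup_right
  have hinfI : idealSubmodule H (I ⊓ J) ≤ idealSubmodule H I := idealSubmodule_mono inf_le_left
  have hinfJ : idealSubmodule H (I ⊓ J) ≤ idealSubmodule H J := idealSubmodule_mono inf_le_right
  have h_dense_neg : ∀ z : ℂ, star z = -z → idealSubmodule H (I ⊓ J) ≤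
      ((idealSubmodule H (I ⊓ J)).map (a.1 + z • -b.1).toLinearMap).topologicalClosure :=
    fun z hz => by simpa using h_dense (-z) (by simpa using congrArg Neg.neg hz)
  refine isomorphic_of_denseRange (isAdjointPair_rotationMap ha hb ?_ ?_)
    (denseRange_rotationMap _ ?_) (denseRange_rotationMap _ ?_)
  · exact fun v hv => ⟨add_mem (hIsup (haI _)) (hJsup (hbJ _)),
      sub_mem (haJ _ hv.2) (hbI _ hv.1)⟩
  · exact fun v hv => ⟨add_mem (haI _) (neg_mem (hinfI (hbI _ (hinfI hv.2)))),
      sub_mem (hinfJ (haJ _ (hinfJ hv.2))) (neg_mem (hbJ _))⟩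
  · rw [idealSubmodule_sup]
    exact topologicalClosure_sup_prod_le_rotationRange ha_dense hb_dense haJ hbI
      ((prod_self_le_rotationRange h_dense).trans (rotationRange_mono hinfI hinfJ))
  · exact prod_le_rotationRange_neg hIsup hJsup ha_dense hb_dense haJ hbI
      ((prod_self_le_rotationRange h_dense_neg).trans
        (rotationRange_mono (hinfI.trans hIsup) le_rfl))

theorem gramOperator_apply_mem_idealSubmodule (x : ℕ → idealSubmodule H I) (w : H) :
    (gramOperator Aᵐᵒᵖ fun n => (x n : H)).1 w ∈ idealSubmodule H I :=
  gramOperator_apply_mem (isClosed_idealSubmodule I) fun n => smul_mem_idealSubmodule I _ (x n).2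

theorem gramOperator_apply_mem_idealSubmodule_inf (x : ℕ → idealSubmodule H I) {w : H}
    (hw : w ∈ idealSubmodule H J) :
    (gramOperator Aᵐᵒᵖ fun n => (x n : H)).1 w ∈ idealSubmodule H (I ⊓ J) :=
  gramOperator_apply_mem (isClosed_idealSubmodule _) fun n =>
    inner_smul_self_mem_idealSubmodule_inf (x n).2 hw

theorem idealSubmodule_le_topologicalClosure_map_gramOperator_add {x : ℕ → H}
    {b : Adjointable Aᵐᵒᵖ H} (hb : IsSelfAdjoint b) {z : ℂ} (hz : star z = -z)
    (hx : idealSubmodule H I ≤ generatedSubmodule Aᵐᵒᵖ x) :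
    idealSubmodule H I ≤ ((idealSubmodule H I).map
      (gramOperator Aᵐᵒᵖ x + z • b).1.toLinearMap).topologicalClosure :=
  le_topologicalClosure_map_gramOperator_add hb hz
    (fun R _ hv => Adjointable.map_mem_idealSubmodule R hv) hx

theorem idealSubmodule_le_topologicalClosure_map_gramOperator {x : ℕ → H}
    (hx : idealSubmodule H I ≤ generatedSubmodule Aᵐᵒᵖ x) :
    idealSubmodule H I ≤
      ((idealSubmodule H I).map (gramOperator Aᵐᵒᵖ x).1.toLinearMap).topologicalClosure := by
  simpa using idealSubmodule_le_topologicalClosure_map_gramOperator_add (z := 0)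
    (IsSelfAdjoint.zero (Adjointable Aᵐᵒᵖ H)) (by simp) hx

end Isomorphism

end RightHilbert

open RightHilbert in
theorem mainTheorem6_general {A : Type*} [NonUnitalCStarAlgebra A] [PartialOrder A]
    [StarOrderedRing A] (I J : TwoSidedIdeal A)
    (H : Type*) [NormedAddCommGroup H] [NormedSpace ℂ H] [CompleteSpace H]
    [SMul Aᵐᵒᵖ H] [CStarModule Aᵐᵒᵖ H]
    (hI : CountablyGenerated (A := A) (idealSubmodule H I))
    (hJ : CountablyGenerated (A := A) (idealSubmodule H J)) :
    Isomorphic A C⋆ᵐᵒᵈ(Aᵐᵒᵖ, idealSubmodule H I × idealSubmodule H J)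
      C⋆ᵐᵒᵈ(Aᵐᵒᵖ, idealSubmodule H (I ⊔ J) × idealSubmodule H (I ⊓ J)) := by
  obtain ⟨x, hx⟩ := countablyGenerated_idealSubmodule_iff.mp hI
  obtain ⟨y, hy⟩ := countablyGenerated_idealSubmodule_iff.mp hJ
  have ha := (gramOperator_nonneg (B := Aᵐᵒᵖ) fun n => (x n : H)).isSelfAdjoint
  have hb := (gramOperator_nonneg (B := Aᵐᵒᵖ) fun n => (y n : H)).isSelfAdjoint
  refine isomorphic_prod_sup_inf ha hb
    (gramOperator_apply_mem_idealSubmodule x) (gramOperator_apply_mem_idealSubmodule y)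
    (fun v => gramOperator_apply_mem_idealSubmodule_inf x)
    (fun v hv => inf_comm I J ▸ gramOperator_apply_mem_idealSubmodule_inf y hv) ?_ ?_ fun z hz => ?_
  · exact idealSubmodule_le_topologicalClosure_map_gramOperator hx
  · exact idealSubmodule_le_topologicalClosure_map_gramOperator hy
  · exact idealSubmodule_le_topologicalClosure_map_gramOperator_add hb hz
      ((idealSubmodule_mono inf_le_left).trans hx)

theorem mainTheorem6 {A : Type*} [NonUnitalCStarAlgebra A] [PartialOrder A] [StarOrderedRing A]
    (I J : TwoSidedIdeal A) (hI : IsClosed (I : Set A)) (hJ : IsClosed (J : Set A))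
    (hIσ : RightHilbert.IsSigmaUnital I) (hJσ : RightHilbert.IsSigmaUnital J)
    (H : Type*) [NormedAddCommGroup H] [NormedSpace ℂ H] [CompleteSpace H]
    [SMul Aᵐᵒᵖ H] [CStarModule Aᵐᵒᵖ H] (hH : RightHilbert.CountablyGenerated (A := A) H) :
    RightHilbert.Isomorphic A
      C⋆ᵐᵒᵈ(Aᵐᵒᵖ, RightHilbert.idealSubmodule H I × RightHilbert.idealSubmodule H J)
      C⋆ᵐᵒᵈ(Aᵐᵒᵖ, RightHilbert.idealSubmodule H (I ⊔ J) ×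
        RightHilbert.idealSubmodule H (I ⊓ J)) :=
  mainTheorem6_general I J H (RightHilbert.countablyGenerated_idealSubmodule hIσ hH)
    (RightHilbert.countablyGenerated_idealSubmodule hJσ hH)
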